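/- Consider the following synchronous algorithm $A_{est}$ on processors $P=[n]=\{1,\dots,n\}$ ($n\ge 1$), where $\log$ is to base $2$, and "random" means uniform and independent of all other choices. The adversary is oblivious: before the computation it fixes, for each processor $i$, a probability $p_i\in(0,1]$ with which $i$ performs any task correctly, independently of everything else, and the step (if any) from which $i$ is crashed. There is no restriction on the number of crashes or on their times. A crashed processor does nothing any more. Given $\epsilon,\delta>0$, put $\Gamma=4(e-2)\ln(2/\delta)/\epsilon^2$ and $\Gamma_1=1+(1+\epsilon)\Gamma$. Each processor $i$ keeps sets $R_i[j]$ of result indicators for $j\in P$ (initially empty), a round counter $r$ (initially $0$), a level $\ell_i$ (initially $0$) and a flag "enlightened" (initially false). A round has three stages, each consisting of a Send, a Receive and a Compute step; crashes take effect between steps. * QUERY: $i$ sends a test task to a random $q\in P$. A processor that receives more than $\lceil\log n\rceil$ tasks performs a random selection of $\lceil \log n\rceil$ of them, otherwise it performs all of them. * RESPONSE: results are returned to the requesters. Processor $i$ adds $(1,i,r)$ to $R_i[q]$ if the result received from its target $q$ is correct, $(0,i,r)$ if it is incorrect, and $(-1,i,r)$ if there is no response. If for every $j\in P$ the set $R_i[j]$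 contains at least $\Gamma_1$ indicators with value $1$, or one with value $-1$, then $i$ becomes enlightened. * GOSSIP, Send: if $i$ is enlightened, it sends *profess* messages carrying $R_i$, $\ell_i$ and $i$ to $\lceil 2^{\ell_i-1}\log n\rceil$ destinations, each drawn at random from $P$ (with repetition), and its level then grows by $1$; otherwise it sends one *share* message, with the same content, to a random processor. Receive: a processor that receives a profess message becomes enlightened; if it receives one from a processor of higher priority, it resets its level to $0$. Here $j$ has higher priority than $i$ if $(\ell_i,i)$ is lexicographically smaller than $(\ell_j,j)$, for the levels with which the two processors enter the gossip stage. Compute: a processor merges the received sets into its own, and halts for good if a received message carries a level $\ge\lceil\log n\rceil$; otherwise it increments $r$. Then there are constants $C,K,\alpha>0$ such that for all $n\ge1$, all $\epsilon,\delta>0$, every such adversary and every number $T$ of rounds, with probability at least $1-Kn^{-\alpha}$ the following holds: in the Send step of the GOSSIP stage of each of the first $T$ rounds, at most $C\,n\log n$ profess messages are sent in total. (The constants do not depend on $T$, so with high probability the bound holds in all rounds of the execution.) -/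

import Mathlib

open scoped ENNReal NNReal

namespace GossipEstimation

/-! ### Elementary randomness -/

/-- The joint law of finitely many independent finite random variables, `f i` having law `p i`. -/
noncomputable def indep {ι : Type} [Fintype ι] [DecidableEq ι] {α : ι → Type}
    [∀ i, Fintype (α i)] (p : ∀ i, PMF (α i)) : PMF (∀ i, α i) :=
  PMF.ofFintype (fun f => ∏ i, p i (f i)) (by
    have h : ∀ i, ∑ a, p i a = 1 := fun i => by
      rw [← tsum_fintype (L := .unconditional _)]; exact (p i).tsum_coe
    have h2 := Finset.prod_univ_sum (fun i => (Finset.univ : Finset (α i))) (fun i a => p i a)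
    rw [Fintype.piFinset_univ] at h2
    rw [← h2]
    simp [h])

/-- A coin that shows `true` with probability `p`. -/
noncomputable def coin (p : ℝ≥0) (hp : p ≤ 1) : PMF Bool :=
  PMF.ofFintype (fun b => if b then (p : ℝ≥0∞) else 1 - (p : ℝ≥0∞)) (by simp [hp])

/-- A uniformly random subset of `M` with `k` elements, or `M` itself if it has fewer. -/
noncomputable def randomSubset {β : Type} (M : Finset β) (k : ℕ) : PMF (Finset β) :=
  PMF.uniformOfFinset (M.powersetCard (min M.card k))
    (Finset.powersetCard_nonempty.2 (min_le_left _ _))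

/-! ### Constants of the algorithm -/

/-- `⌈log n⌉`, with the logarithm to base `2`. -/
noncomputable def ceilLog (n : ℕ) : ℕ := ⌈Real.logb 2 n⌉₊

/-- `2 ^ (ℓ - 1) * log n`, rounded up: the number of destinations of a profess multicast. -/
noncomputable def professSize (n ℓ : ℕ) : ℕ :=
  ⌈(2 : ℝ) ^ ((ℓ : ℤ) - 1) * Real.logb 2 n⌉₊

/-- `Γ = 4 λ log (2 / δ) / ε ^ 2` with `λ = e - 2`. -/
noncomputable def Gam (ε δ : ℝ) : ℝ := 4 * (Real.exp 1 - 2) * Real.log (2 / δ) / ε ^ 2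

/-- `Γ₁ = 1 + (1 + ε) Γ`. -/
noncomputable def Gam1 (ε δ : ℝ) : ℝ := 1 + (1 + ε) * Gam ε δ

/-! ### Adversary and processor states -/

/-- An oblivious adversary. Before the computation it fixes the reliabilities `p i` and, for each
processor, the number `crash i` of synchronous steps that the processor executes before it crashes
(`⊤` if it never crashes). Round `t` consists of the nine steps `9 * t, …, 9 * t + 8`. -/
structure Adversary (n : ℕ) where
  p : Fin n → ℝ≥0
  p_pos : ∀ i, 0 < p i
  p_le_one : ∀ i, p i ≤ 1
  crash : Fin n → ℕ∞

/-- A result indicator `(res, src, rnd)`: `res` is `1` (correct), `0` (incorrect) or `-1` (no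
response), obtained by processor `src` in round `rnd`. -/
abbrev Indicator (n : ℕ) := ℤ × Fin n × ℕ

/-- The local state of a processor. -/
structure Proc (n : ℕ) where
  /-- `R j` is the set of collected result indicators about processor `j`. -/
  R : Fin n → Finset (Indicator n)
  /-- The round number. -/
  r : ℕ
  /-- The level `ℓ`. -/
  level : ℕ
  enlightened : Bool
  halted : Bool

/-- The local states of all processors. -/
abbrev Config (n : ℕ) := Fin n → Proc n

/-- All processors in the initial state. -/
def initConfig (n : ℕ) : Config n := fun _ =>
  { R := fun _ => ∅, r := 0, level := 0, enlightened := false, halted := false }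

section Round

variable {n : ℕ} (A : Adversary n) (t : ℕ) (c : Config n)

/-- In configuration `c` processor `i` executes step `s` of round `t`: it has not halted and has not
crashed. (Processors halt only in the last step of a round.) -/
def Active (s : ℕ) (i : Fin n) : Prop :=
  (c i).halted = false ∧ ((9 * t + s : ℕ) : ℕ∞) < A.crash i

/-! #### Query and response stages

`q i` is the processor to which `i` sends a test task (only one task per processor and round, so
the requester identifies the request). -/

open Classical in
/-- Step 0 (Send) and step 1 (Receive) of a round: the requesters whose test task is received
by `w`. -/
noncomputable def requests (q : Fin n → Fin n) (w : Fin n) : Finset (Fin n) :=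
  Finset.univ.filter fun i => q i = w ∧ Active A t c 0 i ∧ Active A t c 1 w

open Classical in
/-- The indicator value that `i` records about `q i` in step 4 (Receive, response stage). In step 2
processor `w` performs the tasks of the requesters in `sel w`, and it sends the results in
step 3; `ok i` tells whether the result computed for the task of `i` is correct. -/
noncomputable def outcome (q : Fin n → Fin n) (sel : Fin n → Finset (Fin n)) (ok : Fin n → Bool)
    (i : Fin n) : ℤ :=
  if i ∈ sel (q i) ∧ Active A t c 3 (q i) then (if ok i then 1 else 0) else -1

open Classical in
/-- The arrays `R` after step 4. -/
noncomputable def recorded (q : Fin n → Fin n) (sel : Fin n → Finset (Fin n)) (ok : Fin n → Bool)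
    (i : Fin n) : Fin n → Finset (Indicator n) :=
  if Active A t c 4 i then
    Function.update (c i).R (q i) ((c i).R (q i) ∪ {(outcome A t c q sel ok i, i, (c i).r)})
  else (c i).R

/-- The test by which a processor becomes enlightened: for every `j` there are enough correct
results of `j`, or `j` has been recorded as crashed. -/
def Sufficient (Γ₁ : ℝ) (R : Fin n → Finset (Indicator n)) : Prop :=
  ∀ j, Γ₁ ≤ (∑ x ∈ R j, if x.1 = 1 then (1 : ℝ) else 0) ∨ ∃ x ∈ R j, x.1 = -1

open Classical in
/-- The configuration at the end of the response stage (step 5 is its Compute step). -/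
noncomputable def afterResponse (Γ₁ : ℝ) (q : Fin n → Fin n) (sel : Fin n → Finset (Fin n))
    (ok : Fin n → Bool) : Config n := fun i =>
  { c i with
    R := recorded A t c q sel ok i
    enlightened :=
      if Active A t c 5 i ∧ Sufficient Γ₁ (recorded A t c q sel ok i) then true
      else (c i).enlightened }

/-! #### Gossip stage

From here on `c` is the configuration at the start of the gossip stage. -/

open Classical in
/-- The number of messages that `i` sends in step 6, the Send step of the gossip stage: a profess
multicast if `i` is enlightened, and one share message otherwise. -/
noncomputable def sendCount (i : Fin n) : ℕ :=
  if Active A t c 6 i then (if (c i).enlightened then professSize n (c i).level else 1) else 0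

/-- The total number of profess messages that are sent in the Send step of the gossip stage. -/
noncomputable def professMessages : ℕ :=
  ∑ i, if (c i).enlightened then sendCount A t c i else 0

/-- `dest j k` is the destination of the `k`-th message of `j`. All messages of `j` carry the same
content: the type (profess if `j` is enlightened, else share), `R`, `ℓ` and the id of `j`. -/
abbrev Dest := ∀ j, Fin (sendCount A t c j) → Fin n

open Classical in
/-- The processors from which a message is addressed to `i`. -/
noncomputable def senders (dest : Dest A t c) (i : Fin n) : Finset (Fin n) :=
  Finset.univ.filter fun j => ∃ k, dest j k = i

/-- Processor `j` has higher priority than processor `i`: `(ℓ_i, i) ≺ (ℓ_j, j)`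
lexicographically. -/
def HigherPriority (j i : Fin n) : Prop :=
  (c i).level < (c j).level ∨ ((c i).level = (c j).level ∧ i < j)

open Classical in
/-- The configuration at the end of the gossip stage (steps 6, 7 and 8: Send, Receive, Compute). A
halting processor writes its output, which does not influence the rest of the computation. -/
noncomputable def afterGossip (dest : Dest A t c) : Config n := fun i =>
  let M := senders A t c dest i
  let sentLevel :=
    if Active A t c 6 i ∧ (c i).enlightened = true then (c i).level + 1 else (c i).level
  let halts : Prop := Active A t c 8 i ∧ ∃ j ∈ M, ceilLog n ≤ (c j).level
  { R := if Active A t c 8 i then fun k => (c i).R k ∪ M.biUnion (fun j => (c j).R k) else (c i).R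
    r := if Active A t c 8 i ∧ ¬ halts then (c i).r + 1 else (c i).r
    level :=
      if Active A t c 7 i ∧ ∃ j ∈ M, (c j).enlightened = true ∧ HigherPriority c j i then 0
      else sentLevel
    enlightened :=
      if Active A t c 7 i ∧ ∃ j ∈ M, (c j).enlightened = true then true else (c i).enlightened
    halted := if halts then true else (c i).halted }

end Round

/-! ### The random execution -/

/-- Law of the configuration at the end of the response stage of round `t`, started from `c`.
Each processor selects a uniformly random target; a processor that receives more than `⌈log n⌉`
tasks performs a random selection of `⌈log n⌉` of them; each task performed by `w` is done
correctly with probability `A.p w`. All choices are independent. Which test task is sent plays no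
role, since `w` returns a correct result with the same probability on all of them. -/
noncomputable def queryResponse {n : ℕ} [NeZero n] (A : Adversary n) (Γ₁ : ℝ) (t : ℕ)
    (c : Config n) : PMF (Config n) :=
  (PMF.uniformOfFintype (Fin n → Fin n)).bind fun q =>
  (indep fun w => randomSubset (requests A t c q w) (ceilLog n)).bind fun sel =>
  (indep fun i => coin (A.p (q i)) (A.p_le_one (q i))).map fun ok =>
    afterResponse A t c Γ₁ q sel ok

/-- Law of the configuration at the end of a gossip stage started from `c`: all destinations are
chosen independently and uniformly from the set of all processors. -/
noncomputable def gossip {n : ℕ} [NeZero n] (A : Adversary n) (t : ℕ) (c : Config n) :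
    PMF (Config n) :=
  (PMF.uniformOfFintype (Dest A t c)).map fun dest => afterGossip A t c dest

/-- Law of the first `T` rounds of an execution: the list of the numbers of profess messages sent
in the rounds `T - 1, …, 1, 0`, together with the configuration after these rounds. -/
noncomputable def execution {n : ℕ} [NeZero n] (A : Adversary n) (Γ₁ : ℝ) :
    ℕ → PMF (List ℕ × Config n)
  | 0 => PMF.pure ([], initConfig n)
  | T + 1 =>
    (execution A Γ₁ T).bind fun h =>
    (queryResponse A Γ₁ T h.2).bind fun c =>
    (gossip A T c).map fun c' => (professMessages A T c :: h.1, c')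

end GossipEstimation

namespace GossipEstimation

/-! ### Expectations under a probability mass function -/

/-! The invariant is `Bounded`: processors of positive level have multicasts of total size at most
26 n log n. Those of level 0 add at most 2 n log n profess messages, whence the constant 28.

The invariant survives a round unless the destinations are `Atypical`. Let `m` have the lowest
priority among the processors that start the next round with positive level. The others are all
superiors of `m`, yet none of them reached `m`, since a profess message from a superior would have
reset it. So typically they sent fewer than 4 n log n messages; `m` itself accounts for at most 9 n
log n, and one level up at most doubles the sizes: 2(9 + 4) = 26. Levels stay below the cap
`topLevel` plus one because a multicast at the cap typically halts everybody it finds alive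
(`Bounded.level_lt_topLevel`, `Bounded.afterGossip`).

A round is atypical with probability at most 2/n³, but a union bound over `T` rounds would depend on
`T`. Only rounds with profess messages can be atypical, and in each of these either a processor
drops out or the maximal level grows. The potential `budget`, initially O(n²), bounds their number,
so 2/n³ times the budget, truncated at 1 and set to 1 after a failure, is a supermartingale
(`expect_risk_execution_le`). Its initial value is O(1/n). -/

/-- The expectation of a nonnegative function. -/
noncomputable def expect {α : Type} (p : PMF α) (f : α → ℝ≥0∞) : ℝ≥0∞ := ∑' a, p a * f a

lemma expect_bind {α β : Type} (p : PMF α) (g : α → PMF β) (f : β → ℝ≥0∞) :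
    expect (p.bind g) f = expect p fun a => expect (g a) f := by
  simp only [expect, PMF.bind_apply, ← ENNReal.tsum_mul_left, ← ENNReal.tsum_mul_right]
  rw [ENNReal.tsum_comm]
  simp only [mul_assoc]

lemma expect_pure {α : Type} (a : α) (f : α → ℝ≥0∞) : expect (PMF.pure a) f = f a := by
  rw [expect, tsum_eq_single a]
  · simp
  · intro b hb
    simp [PMF.pure_apply, hb]

lemma expect_map {α β : Type} (p : PMF α) (g : α → β) (f : β → ℝ≥0∞) :
    expect (p.map g) f = expect p fun a => f (g a) := by
  rw [PMF.map, expect_bind]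
  simp [expect_pure]

lemma expect_const {α : Type} (p : PMF α) (b : ℝ≥0∞) : expect p (fun _ => b) = b := by
  simp [expect, ENNReal.tsum_mul_right, p.tsum_coe]

lemma expect_add {α : Type} (p : PMF α) (f g : α → ℝ≥0∞) :
    expect p (fun a => f a + g a) = expect p f + expect p g := by
  simp only [expect, mul_add, ENNReal.tsum_add]

lemma expect_mono {α : Type} (p : PMF α) {f g : α → ℝ≥0∞} (h : ∀ a ∈ p.support, f a ≤ g a) :
    expect p f ≤ expect p g := by
  refine ENNReal.tsum_le_tsum fun a => ?_
  by_cases ha : a ∈ p.support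
  · exact mul_le_mul_right (h a ha) _
  · simp [(PMF.apply_eq_zero_iff p a).2 ha]

lemma expect_indicator {α : Type} (p : PMF α) (s : Set α) :
    expect p (s.indicator 1) = p.toOuterMeasure s := by
  rw [PMF.toOuterMeasure_apply, expect]
  refine tsum_congr fun a => ?_
  by_cases ha : a ∈ s <;> simp [ha]

lemma one_sub_le_toOuterMeasure {α : Type} (p : PMF α) (s : Set α) {b : ℝ≥0∞}
    (h : p.toOuterMeasure sᶜ ≤ b) : 1 - b ≤ p.toOuterMeasure s := by
  rw [tsub_le_iff_right]
  calc (1 : ℝ≥0∞) = expect p fun _ => 1 := (expect_const p 1).symm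
    _ = expect p fun a => s.indicator 1 a + sᶜ.indicator 1 a := by
        congr 1; funext a
        by_cases ha : a ∈ s <;> simp [ha]
    _ = p.toOuterMeasure s + p.toOuterMeasure sᶜ := by
        rw [expect_add, expect_indicator, expect_indicator]
    _ ≤ _ := by gcongr

/-! ### Numerical estimates -/

lemma one_le_logb {n : ℕ} (hn : 2 ≤ n) : 1 ≤ Real.logb 2 n := by
  rw [Real.le_logb_iff_rpow_le one_lt_two (by positivity)]
  simpa using (by exact_mod_cast hn : (2 : ℝ) ≤ n)

lemma le_two_pow_ceilLog {n : ℕ} (hn : 2 ≤ n) : (n : ℝ) ≤ 2 ^ ceilLog n := by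
  have h : Real.logb 2 n ≤ ceilLog n := Nat.le_ceil _
  rw [Real.logb_le_iff_le_rpow one_lt_two (by positivity)] at h
  simpa using h

lemma two_pow_ceilLog_le {n : ℕ} (hn : 2 ≤ n) : (2 : ℝ) ^ ceilLog n ≤ 2 * n := by
  have h : (ceilLog n : ℝ) - 1 ≤ Real.logb 2 n := by
    have := Nat.ceil_lt_add_one (zero_le_one.trans (one_le_logb hn))
    unfold ceilLog
    linarith
  rw [Real.le_logb_iff_rpow_le one_lt_two (by positivity), Real.rpow_sub two_pos] at h
  simp only [Real.rpow_natCast, Real.rpow_one] at h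
  linarith

lemma professSize_mono {n : ℕ} (hn : 2 ≤ n) {a b : ℕ} (h : a ≤ b) :
    professSize n a ≤ professSize n b := by
  have := one_le_logb hn
  refine Nat.ceil_mono (mul_le_mul_of_nonneg_right ?_ (by linarith))
  exact zpow_le_zpow_right₀ one_le_two (by lia)

lemma professSize_succ_le (n ℓ : ℕ) : professSize n (ℓ + 1) ≤ 2 * professSize n ℓ := by
  unfold professSize
  refine Nat.ceil_le.2 ?_
  have h : (2 : ℝ) ^ (((ℓ + 1 : ℕ) : ℤ) - 1) = 2 * 2 ^ ((ℓ : ℤ) - 1) := by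
    rw [mul_comm, ← zpow_add_one₀ two_ne_zero]
    congr 1
    push_cast
    ring
  rw [h, mul_assoc]
  push_cast
  gcongr
  exact Nat.le_ceil _

lemma professSize_zero_le {n : ℕ} (hn : 2 ≤ n) : (professSize n 0 : ℝ) ≤ 2 * Real.logb 2 n := by
  have h1 := one_le_logb hn
  have h : ((2 : ℝ) ^ (((0 : ℕ) : ℤ) - 1) * Real.logb 2 n) ≤ Real.logb 2 n := by
    norm_num
    linarith
  have := Nat.ceil_lt_add_one (a := (2 : ℝ) ^ (((0 : ℕ) : ℤ) - 1) * Real.logb 2 n) (by positivity)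
  unfold professSize
  linarith

/-- A level at which a multicast reaches everybody with high probability. -/
noncomputable def topLevel (n : ℕ) : ℕ := ceilLog n + 3

lemma two_zpow_topLevel (n : ℕ) : (2 : ℝ) ^ ((topLevel n : ℤ) - 1) = 4 * 2 ^ ceilLog n := by
  have : ((topLevel n : ℤ) - 1) = ((ceilLog n + 2 : ℕ) : ℤ) := by
    unfold topLevel; push_cast; ring
  rw [this, zpow_natCast, pow_add]
  ring

lemma le_professSize_topLevel {n : ℕ} (hn : 2 ≤ n) :
    4 * (n * Real.logb 2 n) ≤ professSize n (topLevel n) := by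
  refine le_trans ?_ (Nat.le_ceil _)
  rw [two_zpow_topLevel]
  have := le_two_pow_ceilLog hn
  have := one_le_logb hn
  nlinarith

/-- The factor 4 · 2^⌈log n⌉ is at most 8n, and rounding up costs at most 1 ≤ n log n. -/
lemma professSize_topLevel_le {n : ℕ} (hn : 2 ≤ n) :
    (professSize n (topLevel n) : ℝ) ≤ 9 * (n * Real.logb 2 n) := by
  have h1 := one_le_logb hn
  have h2 := two_pow_ceilLog_le hn
  have h3 : (2 : ℝ) ≤ n := by exact_mod_cast hn
  have := Nat.ceil_lt_add_one (a := (2 : ℝ) ^ ((topLevel n : ℤ) - 1) * Real.logb 2 n)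
    (by positivity)
  rw [two_zpow_topLevel] at this
  unfold professSize
  rw [two_zpow_topLevel]
  nlinarith

/-- Bound by exp(-S/n); the natural logarithm is at most the binary one, so S/n ≥ 4 ln n. -/
lemma miss_pow_le {n S : ℕ} (hn : 2 ≤ n) (hS : 4 * (n * Real.logb 2 n) ≤ S) :
    (1 - 1 / (n : ℝ)) ^ S ≤ (n : ℝ) ^ (-4 : ℝ) := by
  have hn' : (2 : ℝ) ≤ n := by exact_mod_cast hn
  have hlog : Real.log n ≤ Real.logb 2 n := by
    rw [Real.logb, le_div_iff₀ (Real.log_pos one_lt_two)]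
    have h2 := Real.log_two_lt_d9
    have : 0 ≤ Real.log n := Real.log_nonneg (by linarith)
    nlinarith
  have h0 : 0 ≤ 1 - 1 / (n : ℝ) := by
    rw [sub_nonneg, div_le_one (by linarith)]
    linarith
  calc (1 - 1 / (n : ℝ)) ^ S ≤ Real.exp (-(1 / (n : ℝ))) ^ S :=
        pow_le_pow_left₀ h0 (Real.one_sub_le_exp_neg _) _
    _ = Real.exp (-(S / (n : ℝ))) := by rw [← Real.exp_nat_mul]; congr 1; ring
    _ ≤ Real.exp (Real.log n * (-4)) := by
        refine Real.exp_le_exp.2 ?_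
        have : 4 * Real.log n ≤ S / (n : ℝ) := by
          rw [le_div_iff₀ (by linarith)]
          nlinarith
        linarith
    _ = _ := by rw [Real.rpow_def_of_pos (by linarith)]

/-! ### Uniform destinations -/

lemma card_miss {n : ℕ} (s : Fin n → ℕ) (J : Finset (Fin n)) (i : Fin n) :
    Nat.card {d : ∀ j, Fin (s j) → Fin n | ∀ j ∈ J, ∀ k, d j k ≠ i} =
      ∏ j, (if j ∈ J then n - 1 else n) ^ s j := by
  classical
  have h : {d : ∀ j, Fin (s j) → Fin n | ∀ j ∈ J, ∀ k, d j k ≠ i} =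
      (Fintype.piFinset fun j => Fintype.piFinset fun _ : Fin (s j) =>
        if j ∈ J then Finset.univ.erase i else Finset.univ : Finset _) := by
    ext d
    simp only [Set.mem_ofPred_eq, SetLike.mem_coe, Fintype.mem_piFinset]
    refine forall_congr' fun j => ?_
    by_cases hj : j ∈ J <;> simp [hj]
  rw [h]
  rw [Nat.card_eq_fintype_card]
  simp only [Fintype.card_coe, SetLike.coe_sort_coe, Fintype.card_piFinset, Finset.prod_const, Finset.card_univ,
    Fintype.card_fin]
  refine Finset.prod_congr rfl fun j _ => ?_
  by_cases hj : j ∈ J <;> simp [hj]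

lemma measure_miss_le {n : ℕ} [NeZero n] (hn : 2 ≤ n) (s : Fin n → ℕ) (J : Finset (Fin n))
    (i : Fin n) (hS : 4 * (n * Real.logb 2 n) ≤ (∑ j ∈ J, s j : ℕ)) :
    (PMF.uniformOfFintype (∀ j, Fin (s j) → Fin n)).toOuterMeasure
      {d | ∀ j ∈ J, ∀ k, d j k ≠ i} ≤ ENNReal.ofReal ((n : ℝ) ^ (-4 : ℝ)) := by
  classical
  rw [PMF.toOuterMeasure_uniformOfFintype_apply, ← Nat.card_eq_fintype_card, card_miss]
  have hn0 : (n : ℝ) ≠ 0 := by positivity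
  rw [← ENNReal.ofReal_natCast, ← ENNReal.ofReal_natCast, ← ENNReal.ofReal_div_of_pos
    (by exact_mod_cast Fintype.card_pos)]
  refine ENNReal.ofReal_le_ofReal (le_trans (le_of_eq ?_) (miss_pow_le hn hS))
  simp only [Fintype.card_pi, Fintype.card_fin, Finset.prod_const, Finset.card_univ]
  push_cast
  rw [← Finset.prod_div_distrib, ← Finset.prod_pow_eq_pow_sum, ← Finset.prod_subset
    (Finset.subset_univ J)]
  · refine Finset.prod_congr rfl fun j hj => ?_
    rw [if_pos hj, ← div_pow, Nat.cast_sub (by lia)]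
    congr 1
    field_simp
    simp
  · intro j _ hj
    rw [if_neg hj, div_self (pow_ne_zero _ hn0)]

/-- Union bound over the n possible targets. The group `J i` may depend on `i`, but it is fixed
before the destinations are drawn. -/
lemma measure_exists_miss_le {n : ℕ} [NeZero n] (hn : 2 ≤ n) (s : Fin n → ℕ)
    (J : Fin n → Finset (Fin n)) :
    (PMF.uniformOfFintype (∀ j, Fin (s j) → Fin n)).toOuterMeasure
      {d | ∃ i, 4 * (n * Real.logb 2 n) ≤ (∑ j ∈ J i, s j : ℕ) ∧ ∀ j ∈ J i, ∀ k, d j k ≠ i} ≤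
      ENNReal.ofReal ((n : ℝ) ^ (-3 : ℝ)) := by
  have hn' : (0 : ℝ) < n := by positivity
  rw [Set.ofPred_exists]
  refine (MeasureTheory.measure_iUnion_le _).trans ?_
  calc _ ≤ ∑' i : Fin n, ENNReal.ofReal ((n : ℝ) ^ (-4 : ℝ)) := by
        refine ENNReal.tsum_le_tsum fun i => ?_
        by_cases h : 4 * (n * Real.logb 2 n) ≤ (∑ j ∈ J i, s j : ℕ)
        · refine le_trans (MeasureTheory.measure_mono ?_) (measure_miss_le hn s (J i) i h)
          exact fun d hd => hd.2
        · simp only [h, false_and, Set.ofPred_false, MeasureTheory.measure_empty, zero_le]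
    _ = _ := by
        rw [tsum_fintype, Finset.sum_const, Finset.card_univ, Fintype.card_fin, nsmul_eq_mul,
          ← ENNReal.ofReal_natCast, ← ENNReal.ofReal_mul hn'.le]
        congr 1
        nth_rewrite 1 [← Real.rpow_one (n : ℝ)]
        rw [← Real.rpow_add hn']
        norm_num

/-! ### One round -/

section Round

variable {n : ℕ} {A : Adversary n} {t : ℕ} {c c' : Config n}

lemma Active.mono {s s' : ℕ} {i : Fin n} (h : Active A t c s i) (hs : s' ≤ s) :
    Active A t c s' i :=
  ⟨h.1, lt_of_le_of_lt (by exact_mod_cast (by lia : 9 * t + s' ≤ 9 * t + s)) h.2⟩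

lemma Active.of_halted_eq {s : ℕ} {i : Fin n} (h : Active A t c s i)
    (hc : (c' i).halted = (c i).halted) : Active A t c' s i :=
  ⟨hc.trans h.1, h.2⟩

lemma Active.of_afterGossip {dest : Dest A t c} {i : Fin n}
    (h : Active A (t + 1) (afterGossip A t c dest) 0 i) : Active A t c 8 i := by
  refine ⟨?_, lt_of_le_of_lt (by exact_mod_cast (by lia)) h.2⟩
  have h1 := h.1
  simp only [afterGossip] at h1
  split_ifs at h1
  exact h1

lemma not_exists_mem_senders_of_active_afterGossip {dest : Dest A t c} {i j : Fin n}
    (h : Active A (t + 1) (afterGossip A t c dest) 0 i) (hj : j ∈ senders A t c dest i) :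
    (c j).level < ceilLog n := by
  by_contra hl
  have h1 := h.1
  simp only [afterGossip] at h1
  rw [if_pos ⟨h.of_afterGossip, j, hj, not_lt.1 hl⟩] at h1
  cases h1

lemma mem_senders {dest : Dest A t c} {i j : Fin n} :
    j ∈ senders A t c dest i ↔ ∃ k, dest j k = i := by
  simp [senders]

lemma active_of_mem_senders {dest : Dest A t c} {i j : Fin n} (h : j ∈ senders A t c dest i) :
    Active A t c 6 j := by
  obtain ⟨k, -⟩ := mem_senders.1 h
  by_contra hj
  have := k.2
  simp [sendCount, hj] at this

lemma higherPriority_iff {i j : Fin n} :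
    HigherPriority c j i ↔ toLex ((c i).level, i) < toLex ((c j).level, j) := by
  rw [Prod.Lex.toLex_lt_toLex]
  rfl

/-- The effect of the query and response stages that matters for the gossip stage. -/
structure Responded (c c' : Config n) : Prop where
  level_eq : ∀ i, (c' i).level = (c i).level
  halted_eq : ∀ i, (c' i).halted = (c i).halted
  enlightened : ∀ i, (c i).enlightened = true → (c' i).enlightened = true

lemma responded_afterResponse (Γ₁ : ℝ) (q : Fin n → Fin n) (sel : Fin n → Finset (Fin n))
    (ok : Fin n → Bool) : Responded c (afterResponse A t c Γ₁ q sel ok) where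
  level_eq _ := rfl
  halted_eq _ := rfl
  enlightened i h := by simp [afterResponse, h]

lemma responded_of_mem_support [NeZero n] {Γ₁ : ℝ}
    (h : c' ∈ (queryResponse A Γ₁ t c).support) : Responded c c' := by
  simp only [queryResponse, PMF.mem_support_bind_iff, PMF.mem_support_map_iff] at h
  obtain ⟨q, -, sel, -, ok, -, rfl⟩ := h
  exact responded_afterResponse Γ₁ q sel ok

/-! ### The invariant and the message bound it implies -/

open Classical in
/-- The configurations at the start of round `t` that lead to few profess messages. -/
structure Bounded (A : Adversary n) (t : ℕ) (c : Config n) : Prop where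
  level_eq_zero : ∀ i, (c i).enlightened = false → (c i).level = 0
  level_le : ∀ i, Active A t c 0 i → (c i).level ≤ topLevel n
  sum_le : ((∑ i with Active A t c 0 i ∧ 1 ≤ (c i).level, professSize n (c i).level : ℕ) : ℝ) ≤
    26 * (n * Real.logb 2 n)

/-- A processor enlightened by its own results has level 0, so it does not enter the sum over
positive levels. -/
lemma Bounded.of_responded (h : Bounded A t c) (hc : Responded c c') : Bounded A t c' where
  level_eq_zero i hi := by
    rw [hc.level_eq]
    refine h.level_eq_zero i ?_
    by_contra h'
    rw [hc.enlightened i (by simpa using h')] at hi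
    cases hi
  level_le i hi := by
    rw [hc.level_eq]
    exact h.level_le i (hi.of_halted_eq (hc.halted_eq i).symm)
  sum_le := by
    have hA : ∀ i, Active A t c' 0 i ↔ Active A t c 0 i := fun i =>
      ⟨fun hi => hi.of_halted_eq (hc.halted_eq i).symm, fun hi => hi.of_halted_eq (hc.halted_eq i)⟩
    classical
    refine le_of_eq_of_le (congrArg _ ?_) h.sum_le
    exact Finset.sum_congr (Finset.filter_congr fun i _ => by rw [hA, hc.level_eq])
      fun i _ => by rw [hc.level_eq]

lemma bounded_initConfig (hn : 2 ≤ n) : Bounded A 0 (initConfig n) where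
  level_eq_zero _ _ := rfl
  level_le _ _ := Nat.zero_le _
  sum_le := by
    have := one_le_logb hn
    classical
    rw [Finset.sum_eq_zero]
    · rw [Nat.cast_zero]
      positivity
    · intro i hi
      have := (Finset.mem_filter.1 hi).2.2
      simp [initConfig] at this

lemma Bounded.professMessages_le (hn : 2 ≤ n) (h : Bounded A t c) :
    (professMessages A t c : ℝ) ≤ 28 * n * Real.logb 2 n := by
  classical
  have h1 : professMessages A t c ≤ n * professSize n 0 +
      ∑ i with Active A t c 0 i ∧ 1 ≤ (c i).level, professSize n (c i).level := by
    have h2 : n * professSize n 0 = ∑ _i : Fin n, professSize n 0 := by simp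
    rw [Finset.sum_filter, h2, ← Finset.sum_add_distrib, professMessages]
    refine Finset.sum_le_sum fun i _ => ?_
    unfold sendCount
    by_cases h6 : Active A t c 6 i
    · have h0 := h6.mono (Nat.zero_le _)
      rcases Nat.eq_zero_or_pos (c i).level with hl | hl
      · split_ifs <;> simp [hl]
      · have hp : Active A t c 0 i ∧ 1 ≤ (c i).level := ⟨h0, hl⟩
        simp only [h6, hp, and_self, if_true]
        split_ifs <;> simp
    · simp [h6]
  have h3 := h.sum_le
  have h4 := professSize_zero_le hn
  have h5 : (professMessages A t c : ℝ) ≤ _ := Nat.cast_le.2 h1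
  rw [Nat.cast_add, Nat.cast_mul] at h5
  have h6 : (n : ℝ) * professSize n 0 ≤ n * (2 * Real.logb 2 n) := by gcongr
  linarith

/-! ### Atypical destinations and preservation of the invariant -/

open Classical in
/-- The processors whose profess messages reset the level of `i`. -/
noncomputable def superiors (c : Config n) (i : Fin n) : Finset (Fin n) :=
  Finset.univ.filter fun j => (c j).enlightened = true ∧ HigherPriority c j i

open Classical in
/-- The enlightened processors of a level at which a multicast reaches everybody. -/
noncomputable def summit (c : Config n) : Finset (Fin n) :=
  Finset.univ.filter fun j => (c j).enlightened = true ∧ topLevel n ≤ (c j).level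

/-- Some processor is not reached by a group of processors that sends it many messages. -/
def Unreached (s : Fin n → ℕ) (J : Fin n → Finset (Fin n)) : Set (∀ j, Fin (s j) → Fin n) :=
  {d | ∃ i, 4 * (n * Real.logb 2 n) ≤ (∑ j ∈ J i, s j : ℕ) ∧ ∀ j ∈ J i, ∀ k, d j k ≠ i}

/-- The atypical choices of destinations. -/
def Atypical (A : Adversary n) (t : ℕ) (c : Config n) : Set (Dest A t c) :=
  Unreached (sendCount A t c) (superiors c) ∪ Unreached (sendCount A t c) fun _ => summit c

lemma exists_mem_senders_of_not_unreached {J : Fin n → Finset (Fin n)} {dest : Dest A t c}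
    (h : dest ∉ Unreached (sendCount A t c) J) {i : Fin n}
    (hi : 4 * (n * Real.logb 2 n) ≤ (∑ j ∈ J i, sendCount A t c j : ℕ)) :
    ∃ j ∈ J i, j ∈ senders A t c dest i := by
  by_contra! h'
  refine h ⟨i, hi, fun j hj k hk => h' j hj (mem_senders.2 ⟨k, hk⟩)⟩

lemma sendCount_of_active {i : Fin n} (h : Active A t c 6 i) (he : (c i).enlightened = true) :
    sendCount A t c i = professSize n (c i).level := by
  simp [sendCount, h, he]

lemma Bounded.enlightened_of_pos (h : Bounded A t c) {i : Fin n} (hi : 1 ≤ (c i).level) :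
    (c i).enlightened = true := by
  by_contra h'
  have := h.level_eq_zero i (by simpa using h')
  lia

/-- A single sender at `topLevel` already sends 4 n log n messages, so typically every processor
hears from the summit; those still running in the last step then halt, and nobody would start the
next round. -/
lemma Bounded.level_lt_topLevel (hn : 2 ≤ n) (h : Bounded A t c) {dest : Dest A t c}
    (hd : dest ∉ Atypical A t c) {i j : Fin n}
    (hi : Active A (t + 1) (afterGossip A t c dest) 0 i) (hj : Active A t c 6 j) :
    (c j).level < topLevel n := by
  by_contra! hl
  have he := h.enlightened_of_pos (i := j) (le_trans (by unfold topLevel; lia) hl)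
  have hmem : j ∈ summit c := by simp [summit, he, hl]
  have hS : professSize n (topLevel n) ≤ ∑ j ∈ summit c, sendCount A t c j :=
    calc _ ≤ sendCount A t c j := by
          rw [sendCount_of_active hj he]
          exact professSize_mono hn hl
      _ ≤ _ := Finset.single_le_sum (fun _ _ => Nat.zero_le _) hmem
  obtain ⟨k, hk, hk'⟩ := exists_mem_senders_of_not_unreached (J := fun _ => summit c)
    (fun h => hd (Or.inr h)) ((le_professSize_topLevel hn).trans (Nat.cast_le.2 hS))
  have h1 := not_exists_mem_senders_of_active_afterGossip hi hk'
  have h2 : topLevel n ≤ (c k).level := by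
    simp only [summit, Finset.mem_filter] at hk
    exact hk.2.2
  unfold topLevel at h2
  lia

lemma afterGossip_level_le (dest : Dest A t c) (i : Fin n) :
    (afterGossip A t c dest i).level ≤ (c i).level + 1 := by
  simp only [afterGossip]
  split_ifs <;> lia

/-- A processor that keeps a positive level has not been reset. -/
lemma Bounded.survivor (h : Bounded A t c) {dest : Dest A t c} {i : Fin n}
    (ha : Active A t c 8 i) (hl : 1 ≤ (afterGossip A t c dest i).level) :
    (c i).enlightened = true ∧ ∀ j ∈ superiors c i, j ∉ senders A t c dest i := by
  simp only [afterGossip] at hl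
  split_ifs at hl with h1 h2
  · lia
  · refine ⟨h2.2, fun j hj hs => h1 ⟨ha.mono (by lia), j, hs, ?_⟩⟩
    simpa [superiors] using hj
  · exact absurd ⟨ha.mono (by lia), h.enlightened_of_pos hl⟩ h2

/-- Positive levels after the round belong to enlightened processors that were not reset. The one of
lowest priority among them bounds the traffic of all the others. -/
lemma Bounded.afterGossip (hn : 2 ≤ n) (h : Bounded A t c) {dest : Dest A t c}
    (hd : dest ∉ Atypical A t c) : Bounded A (t + 1) (afterGossip A t c dest) where
  level_eq_zero i hi := by
    simp only [GossipEstimation.afterGossip] at hi ⊢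
    split_ifs at hi
    have := h.level_eq_zero i hi
    simp [hi, this]
  level_le i hi := by
    have h1 := afterGossip_level_le dest i
    have h2 := h.level_lt_topLevel hn hd hi (hi.of_afterGossip.mono (by lia) : Active A t c 6 i)
    lia
  sum_le := by
    classical
    have hlog := one_le_logb hn
    set c' := GossipEstimation.afterGossip A t c dest with hc'
    set U : Finset (Fin n) := Finset.univ.filter fun i => Active A (t + 1) c' 0 i ∧
      1 ≤ (c' i).level with hU
    have hmem : ∀ i ∈ U, Active A (t + 1) c' 0 i ∧ 1 ≤ (c' i).level := fun i hi => by
      simpa [hU] using hi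
    rcases U.eq_empty_or_nonempty with hE | hE
    · rw [hE]
      simp only [Finset.sum_empty, Nat.cast_zero]
      positivity
    -- Priority is compared with the levels before the gossip stage; the id breaks ties, so the
    -- minimum is strict.
    obtain ⟨m, hm, hmin⟩ := U.exists_min_image (fun i => toLex ((c i).level, i)) hE
    have hact : ∀ i ∈ U, Active A t c 6 i := fun i hi => (hmem i hi).1.of_afterGossip.mono (by lia)
    have hsurv : ∀ i ∈ U, (c i).enlightened = true ∧ ∀ j ∈ superiors c i,
      j ∉ senders A t c dest i := fun i hi =>
        h.survivor (hmem i hi).1.of_afterGossip (hmem i hi).2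
    have hsub : U.erase m ⊆ superiors c m := fun j hj => by
      have hj' := Finset.mem_of_mem_erase hj
      simp only [superiors, Finset.mem_filter, Finset.mem_univ, true_and]
      refine ⟨(hsurv j hj').1, higherPriority_iff.2 (lt_of_le_of_ne (hmin j hj') ?_)⟩
      intro he
      have := congrArg (fun x => (ofLex x).2) he
      exact Finset.ne_of_mem_erase hj this.symm
    have hsup : ((∑ j ∈ superiors c m, sendCount A t c j : ℕ) : ℝ) < 4 * (n * Real.logb 2 n) := by
      by_contra! hS
      obtain ⟨j, hj, hj'⟩ := exists_mem_senders_of_not_unreached (fun h => hd (Or.inl h)) hS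
      exact (hsurv m hm).2 j hj hj'
    have hm' : professSize n (c m).level ≤ professSize n (topLevel n) :=
      professSize_mono hn (h.level_le m ((hact m hm).mono (by lia)))
    -- The multicast of `m` is not among those of its superiors, so it is bounded separately through
    -- the level cap.
    have key : ∑ i ∈ U, professSize n (c' i).level ≤
        2 * (professSize n (topLevel n) + ∑ j ∈ superiors c m, sendCount A t c j) :=
      calc ∑ i ∈ U, professSize n (c' i).level
          ≤ ∑ i ∈ U, 2 * professSize n (c i).level := Finset.sum_le_sum fun i _ =>
            (professSize_mono hn (afterGossip_level_le dest i)).trans (professSize_succ_le n _)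
        _ = 2 * (professSize n (c m).level + ∑ i ∈ U.erase m, professSize n (c i).level) := by
            rw [← Finset.mul_sum, Finset.add_sum_erase U (fun i => professSize n (c i).level) hm]
        _ = 2 * (professSize n (c m).level + ∑ i ∈ U.erase m, sendCount A t c i) := by
            congr 2
            refine Finset.sum_congr rfl fun i hi => ?_
            have hi' := Finset.mem_of_mem_erase hi
            rw [sendCount_of_active (hact i hi') (hsurv i hi').1]
        _ ≤ _ := by
            gcongr
    have key' := Nat.cast_le (α := ℝ).2 key
    have hT := professSize_topLevel_le hn
    push_cast at key' hsup ⊢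
    linarith

/-! ### The budget of rounds with profess messages -/

open Classical in
/-- The processors that start round `t`. -/
noncomputable def starters (A : Adversary n) (t : ℕ) (c : Config n) : Finset (Fin n) :=
  Finset.univ.filter fun i => Active A t c 0 i

/-- The largest level, increased by one, of an enlightened processor that starts round `t`. -/
noncomputable def height (A : Adversary n) (t : ℕ) (c : Config n) : ℕ :=
  ((starters A t c).filter fun i => (c i).enlightened = true).sup fun i => (c i).level + 1

/-- A bound on the number of rounds from `t` on in which profess messages are sent. -/
noncomputable def budget (A : Adversary n) (t : ℕ) (c : Config n) : ℕ :=
  (topLevel n + 2) * (starters A t c).card + (topLevel n + 2 - height A t c)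

/-- Some processor sends profess messages. -/
def Professing (A : Adversary n) (t : ℕ) (c : Config n) : Prop :=
  ∃ i, Active A t c 6 i ∧ (c i).enlightened = true

/-- The threshold 4 n log n is positive, so a silent group never meets it. Hence quiet rounds carry
no risk, which makes the final bound independent of `T`. -/
lemma atypical_eq_empty (hn : 2 ≤ n) (h : ¬ Professing A t c) : Atypical A t c = ∅ := by
  have hpos : (0 : ℝ) < 4 * (n * Real.logb 2 n) := by
    have := one_le_logb hn
    positivity
  have h0 : ∀ j, (c j).enlightened = true → sendCount A t c j = 0 := fun j hj => by
    have : ¬ Active A t c 6 j := fun ha => h ⟨j, ha, hj⟩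
    simp [sendCount, this]
  refine Set.eq_empty_of_forall_notMem fun d hd => ?_
  rcases hd with ⟨i, hi, -⟩ | ⟨i, hi, -⟩
  · rw [Finset.sum_eq_zero] at hi
    · simp only [Nat.cast_zero] at hi
      linarith
    · intro j hj
      simp only [superiors, Finset.mem_filter] at hj
      exact h0 j hj.2.1
  · rw [Finset.sum_eq_zero] at hi
    · simp only [Nat.cast_zero] at hi
      linarith
    · intro j hj
      simp only [summit, Finset.mem_filter] at hj
      exact h0 j hj.2.1

lemma mem_starters {i : Fin n} : i ∈ starters A t c ↔ Active A t c 0 i := by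
  simp [starters]

lemma Bounded.height_le (h : Bounded A t c) : height A t c ≤ topLevel n + 1 := by
  refine Finset.sup_le fun i hi => ?_
  have := h.level_le i (mem_starters.1 (Finset.mem_filter.1 hi).1)
  lia

lemma starters_afterGossip_subset (hc : Responded c c') (dest : Dest A t c') :
    starters A (t + 1) (afterGossip A t c' dest) ⊆ starters A t c := fun i hi =>
  mem_starters.2 (((mem_starters.1 hi).of_afterGossip.mono (Nat.zero_le _)).of_halted_eq
    (hc.halted_eq i).symm)

/-- The highest-priority professing processor cannot be reset, so its level grows by one. As nobody
drops out, it starts the next round, and its old level dominates those of all enlightened starters.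
-/
lemma height_add_one_le (hc : Responded c c') {dest : Dest A t c'}
    (hs : starters A t c ⊆ starters A (t + 1) (afterGossip A t c' dest))
    (hp : Professing A t c') :
    height A t c + 1 ≤ height A (t + 1) (afterGossip A t c' dest) := by
  classical
  obtain ⟨i₀, hi₀⟩ := hp
  obtain ⟨m, hm, hmax⟩ := (Finset.univ.filter fun i => Active A t c' 6 i ∧
    (c' i).enlightened = true).exists_max_image (fun i => toLex ((c' i).level, i))
    ⟨i₀, by simpa using hi₀⟩
  simp only [Finset.mem_filter, Finset.mem_univ, true_and] at hm hmax
  have hnr : ¬ ∃ j ∈ senders A t c' dest m, (c' j).enlightened = true ∧ HigherPriority c' j m := by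
    rintro ⟨j, hj, he, hh⟩
    exact absurd (higherPriority_iff.1 hh) (not_lt.2 (hmax j ⟨active_of_mem_senders hj, he⟩))
  have hl : (afterGossip A t c' dest m).level = (c' m).level + 1 := by
    simp only [afterGossip]
    rw [if_neg (fun h => hnr h.2), if_pos hm]
  have he : (afterGossip A t c' dest m).enlightened = true := by
    simp [afterGossip, hm.2]
  have hms : m ∈ starters A t c :=
    mem_starters.2 ((hm.1.mono (Nat.zero_le _)).of_halted_eq (hc.halted_eq m).symm)
  have h1 : (c' m).level + 2 ≤ height A (t + 1) (afterGossip A t c' dest) := by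
    have := Finset.le_sup (f := fun i => (afterGossip A t c' dest i).level + 1)
      ((Finset.mem_filter (p := fun i => (afterGossip A t c' dest i).enlightened = true)).2
        ⟨hs hms, he⟩)
    unfold height
    simp only [hl] at this
    exact this
  refine le_trans (Nat.add_le_add_right (Finset.sup_le fun i hi => ?_) 1)
    (show (c' m).level + 1 + 1 ≤ _ from h1)
  obtain ⟨his, hie⟩ := Finset.mem_filter.1 hi
  have ha : Active A t c' 6 i := (mem_starters.1 (hs his)).of_afterGossip.mono (by lia)
  have := hmax i ⟨ha, hc.enlightened i hie⟩
  rw [Prod.Lex.toLex_le_toLex] at this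
  rw [← hc.level_eq]
  dsimp at this
  lia

/-- If the starters stay the same, the height rises, and the cap on the old height keeps the
truncated subtraction strictly decreasing. Otherwise a lost starter frees `topLevel n + 2`, enough
to pay for any fall of the height and still gain one. No typicality of the destinations is needed.
-/
lemma Bounded.budget_afterGossip_add_one_le (h : Bounded A t c) (hc : Responded c c')
    (dest : Dest A t c') (hp : Professing A t c') :
    budget A (t + 1) (GossipEstimation.afterGossip A t c' dest) + 1 ≤ budget A t c := by
  have hsub := starters_afterGossip_subset hc dest
  have hh := h.height_le
  unfold budget
  by_cases hs : starters A t c ⊆ starters A (t + 1) (GossipEstimation.afterGossip A t c' dest)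
  · have h1 := height_add_one_le hc hs hp
    rw [hsub.antisymm hs]
    lia
  · have h1 := Finset.card_lt_card (hsub.ssubset_of_not_subset hs)
    have h2 := Nat.mul_le_mul_left (topLevel n + 2) h1
    rw [Nat.succ_eq_add_one, mul_add] at h2
    lia

lemma Bounded.budget_afterGossip_le (h : Bounded A t c) (hc : Responded c c')
    (dest : Dest A t c') :
    budget A (t + 1) (GossipEstimation.afterGossip A t c' dest) ≤ budget A t c := by
  by_cases hp : Professing A t c'
  · exact (Nat.le_succ _).trans (h.budget_afterGossip_add_one_le hc dest hp)
  have hsub := starters_afterGossip_subset hc dest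
  have hh := h.height_le
  unfold budget
  by_cases hs : starters A t c ⊆ starters A (t + 1) (GossipEstimation.afterGossip A t c' dest)
  · have h0 : height A t c = 0 := by
      unfold height
      rw [Finset.filter_false_of_mem, Finset.sup_empty]
      · rfl
      · exact fun i hi he => hp ⟨i, (mem_starters.1 (hs hi)).of_afterGossip.mono (by lia),
          hc.enlightened i he⟩
    rw [hsub.antisymm hs, h0]
    lia
  · have h1 := Finset.card_lt_card (hsub.ssubset_of_not_subset hs)
    have h2 := Nat.mul_le_mul_left (topLevel n + 2) h1
    rw [Nat.succ_eq_add_one, mul_add] at h2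
    lia

lemma budget_le (A : Adversary n) (t : ℕ) (c : Config n) :
    budget A t c ≤ (topLevel n + 2) * (n + 1) := by
  have h1 : (starters A t c).card ≤ n := by simpa using Finset.card_le_univ (starters A t c)
  have h2 := Nat.mul_le_mul_left (topLevel n + 2) h1
  unfold budget
  rw [mul_add]
  lia

lemma measure_atypical_le [NeZero n] (hn : 2 ≤ n) (A : Adversary n) (t : ℕ) (c : Config n) :
    (PMF.uniformOfFintype (Dest A t c)).toOuterMeasure (Atypical A t c) ≤
      ENNReal.ofReal (2 * (n : ℝ) ^ (-3 : ℝ)) := by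
  refine (MeasureTheory.measure_union_le _ _).trans ?_
  rw [two_mul, ENNReal.ofReal_add (by positivity) (by positivity)]
  exact add_le_add (measure_exists_miss_le hn _ _) (measure_exists_miss_le hn _ _)

end Round

/-! ### The execution -/

section Execution

variable {n : ℕ}

/-- All rounds so far had few profess messages, and the next one will have few of them. -/
def Good (A : Adversary n) (t : ℕ) (h : List ℕ × Config n) : Prop :=
  (∀ m ∈ h.1, (m : ℝ) ≤ 28 * n * Real.logb 2 n) ∧ Bounded A t h.2

open Classical in
/-- A bound on the probability that some round has many profess messages. -/
noncomputable def risk (A : Adversary n) (t : ℕ) (h : List ℕ × Config n) : ℝ≥0∞ :=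
  if Good A t h then min 1 (ENNReal.ofReal (2 * (n : ℝ) ^ (-3 : ℝ)) * budget A t h.2) else 1

lemma risk_le_one (A : Adversary n) (t : ℕ) (h : List ℕ × Config n) : risk A t h ≤ 1 := by
  unfold risk
  split_ifs
  · exact min_le_left _ _
  · exact le_rfl

/-- A professing round costs at most `η` in failure probability and lowers the budget by at least
one, so the two compensate; in a quiet round failure is impossible and the budget does not grow. -/
lemma expect_risk_gossip_le [NeZero n] (hn : 2 ≤ n) {A : Adversary n} {t : ℕ}
    {h : List ℕ × Config n} (hg : Good A t h) {c : Config n} (hc : Responded h.2 c) :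
    expect (gossip A t c) (fun c' => risk A (t + 1) (professMessages A t c :: h.1, c')) ≤
      ENNReal.ofReal (2 * (n : ℝ) ^ (-3 : ℝ)) * budget A t h.2 := by
  set η := ENNReal.ofReal (2 * (n : ℝ) ^ (-3 : ℝ)) with hη
  have hb := hg.2.of_responded hc
  have hgood : ∀ dest, dest ∉ Atypical A t c →
      risk A (t + 1) (professMessages A t c :: h.1, afterGossip A t c dest) ≤
        η * budget A (t + 1) (afterGossip A t c dest) := by
    intro dest hd
    have : Good A (t + 1) (professMessages A t c :: h.1, afterGossip A t c dest) := by
      refine ⟨?_, hb.afterGossip hn hd⟩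
      intro m hm
      rcases List.mem_cons.1 hm with rfl | hm
      · exact hb.professMessages_le hn
      · exact hg.1 m hm
    unfold risk
    rw [if_pos this]
    exact min_le_right _ _
  rw [gossip, expect_map]
  by_cases hp : Professing A t c
  · obtain ⟨b, hb'⟩ : ∃ b, budget A t h.2 = b + 1 := by
      obtain ⟨dest⟩ : Nonempty (Dest A t c) := inferInstance
      have := hg.2.budget_afterGossip_add_one_le hc dest hp
      exact ⟨budget A t h.2 - 1, by lia⟩
    calc _ ≤ expect (PMF.uniformOfFintype (Dest A t c))
          (fun dest => (Atypical A t c).indicator 1 dest + η * b) := by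
          refine expect_mono _ fun dest _ => ?_
          by_cases hd : dest ∈ Atypical A t c
          · rw [Set.indicator_of_mem hd]
            exact (risk_le_one _ _ _).trans le_self_add
          · rw [Set.indicator_of_notMem hd, zero_add]
            refine (hgood dest hd).trans ?_
            gcongr
            have := hg.2.budget_afterGossip_add_one_le hc dest hp
            lia
      _ = (PMF.uniformOfFintype (Dest A t c)).toOuterMeasure (Atypical A t c) + η * b := by
          rw [expect_add, expect_indicator, expect_const]
      _ ≤ η + η * b := by
          gcongr
          exact measure_atypical_le hn A t c
      _ = _ := by
          rw [hb']
          push_cast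
          ring
  · calc _ ≤ expect (PMF.uniformOfFintype (Dest A t c)) (fun _ => η * budget A t h.2) := by
          refine expect_mono _ fun dest _ => ?_
          refine (hgood dest (by simp [atypical_eq_empty hn hp])).trans ?_
          gcongr
          exact hg.2.budget_afterGossip_le hc dest
      _ = _ := expect_const _ _

/-- Supermartingale property: the expected risk never increases, so it stays below its initial
value. After a failure the risk is already 1 and nothing more can be lost. -/
lemma expect_risk_execution_le [NeZero n] (hn : 2 ≤ n) (A : Adversary n) (Γ₁ : ℝ) (T : ℕ) :
    expect (execution A Γ₁ T) (risk A T) ≤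
      ENNReal.ofReal (2 * (n : ℝ) ^ (-3 : ℝ)) * budget A 0 (initConfig n) := by
  induction T with
  | zero =>
    rw [execution, expect_pure, risk, if_pos ⟨by simp, bounded_initConfig hn⟩]
    exact min_le_right _ _
  | succ T ih =>
    refine le_trans ?_ ih
    rw [execution, expect_bind]
    refine expect_mono _ fun h _ => ?_
    by_cases hg : Good A T h
    · rw [risk, if_pos hg]
      refine le_min ?_ ?_
      · exact (expect_mono _ fun _ _ => risk_le_one _ _ _).trans (expect_const _ _).le
      · rw [expect_bind]
        refine (expect_mono _ fun c hc => ?_).trans (expect_const _ _).le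
        rw [expect_map]
        exact expect_risk_gossip_le hn hg (responded_of_mem_support hc)
    · rw [risk, if_neg hg]
      exact (expect_mono _ fun _ _ => risk_le_one _ _ _).trans (expect_const _ _).le

lemma measure_not_few_le [NeZero n] (hn : 2 ≤ n) (A : Adversary n) (Γ₁ : ℝ) (T : ℕ) :
    (execution A Γ₁ T).toOuterMeasure {h | ∀ m ∈ h.1, (m : ℝ) ≤ 28 * n * Real.logb 2 n}ᶜ ≤
      ENNReal.ofReal (2 * (n : ℝ) ^ (-3 : ℝ)) * budget A 0 (initConfig n) := by
  refine le_trans ?_ (expect_risk_execution_le hn A Γ₁ T)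
  rw [← expect_indicator]
  refine expect_mono _ fun h _ => ?_
  by_cases hh : h ∈ {h : List ℕ × Config n | ∀ m ∈ h.1, (m : ℝ) ≤ 28 * n * Real.logb 2 n}ᶜ
  · rw [risk, if_neg fun hg => hh hg.1, Set.indicator_of_mem hh]
    rfl
  · rw [Set.indicator_of_notMem hh]
    exact zero_le

lemma topLevel_le (hn : 2 ≤ n) : topLevel n ≤ n + 3 := by
  unfold topLevel ceilLog
  gcongr
  refine Nat.ceil_le.2 ?_
  rw [Real.logb_le_iff_le_rpow one_lt_two (by positivity), Real.rpow_natCast]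
  exact_mod_cast Nat.lt_two_pow_self.le

/-- The crude bound (n + 5)(n + 1) ≤ 6n² on the budget suffices against 2/n³. -/
lemma failure_le (hn : 2 ≤ n) (A : Adversary n) (t : ℕ) (c : Config n) :
    ENNReal.ofReal (2 * (n : ℝ) ^ (-3 : ℝ)) * budget A t c ≤
      ENNReal.ofReal (12 * (n : ℝ) ^ (-1 : ℝ)) := by
  have hn' : (2 : ℝ) ≤ n := by exact_mod_cast hn
  have hn0 : (0 : ℝ) < n := by linarith
  have h1 : (budget A t c : ℝ) ≤ 6 * (n : ℝ) ^ (2 : ℝ) := by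
    have h := (budget_le A t c).trans (Nat.mul_le_mul_right _
      (Nat.add_le_add_right (topLevel_le hn) 2))
    have h' := Nat.cast_le (α := ℝ).2 h
    push_cast at h'
    rw [Real.rpow_two]
    nlinarith
  rw [← ENNReal.ofReal_natCast, ← ENNReal.ofReal_mul (by positivity)]
  refine ENNReal.ofReal_le_ofReal ?_
  calc 2 * (n : ℝ) ^ (-3 : ℝ) * budget A t c
      ≤ 2 * (n : ℝ) ^ (-3 : ℝ) * (6 * (n : ℝ) ^ (2 : ℝ)) := by gcongr
    _ = 12 * ((n : ℝ) ^ (-3 : ℝ) * (n : ℝ) ^ (2 : ℝ)) := by ring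
    _ = _ := by rw [← Real.rpow_add hn0]; norm_num

end Execution

end GossipEstimation

theorem mainTheorem6 :
    ∃ C K α : ℝ, 0 < C ∧ 0 < K ∧ 0 < α ∧
      ∀ (n : ℕ) [NeZero n] (A : GossipEstimation.Adversary n) (ε δ : ℝ), 0 < ε → 0 < δ →
        ∀ T : ℕ,
          1 - ENNReal.ofReal (K * (n : ℝ) ^ (-α)) ≤
            (GossipEstimation.execution A (GossipEstimation.Gam1 ε δ) T).toOuterMeasure
              {h | ∀ m ∈ h.1, (m : ℝ) ≤ C * n * Real.logb 2 n} := by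
  -- Here 28 = 26 + 2 comes from positive levels and level 0, and 12 = 2 · 6 from the risk per round
  -- and the budget. For n = 1 the claim is void because 12 ≥ 1.
  refine ⟨28, 12, 1, by norm_num, by norm_num, by norm_num, ?_⟩
  intro n _ A ε δ _ _ T
  rcases Nat.lt_or_ge n 2 with hn | hn
  · have h1 : n = 1 := by
      have := NeZero.ne n
      lia
    have h2 : (1 : ℝ≥0∞) ≤ ENNReal.ofReal (12 * (n : ℝ) ^ (-1 : ℝ)) := by
      rw [h1, ← ENNReal.ofReal_one]
      refine ENNReal.ofReal_le_ofReal ?_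
      norm_num
    rw [tsub_eq_zero_of_le h2]
    exact zero_le
  · exact GossipEstimation.one_sub_le_toOuterMeasure _ _
      ((GossipEstimation.measure_not_few_le hn A _ T).trans
        (GossipEstimation.failure_le hn A 0 _))
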